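/- Let $(\Omega,\mathcal F,\mathbb P,(\mathcal F_t)_{t\ge 0})$ be a filtered probability space satisfying the usual hypotheses (complete, right-continuous filtration). For a stopping time $T:\Omega\to[0,\infty]$, an *adapted process on $[0,T)$* is a family $X=(X_t)_{t\ge0}$ of maps $X_t:\{t<T\}\to\mathbb R$ such that $X_t$ is measurable for the trace $\sigma$-algebra $\{t<T\}\cap\mathcal F_t$, for every $t\ge 0$. It is *càdlàg on $[0,T)$* if almost surely its path is right-continuous at every $t\in[0,T)$ and has finite left limits at every $t\in(0,T)$. An adapted process $M$ on $[0,T)$ is a *continuous local martingale on $[0,T)$* if there exist an increasing sequence of stopping times $(T_n)_{n\in\mathbb N}$ with $\lim_{n\to\infty}T_n=T$ a.s. and continuous martingales $M^{(n)}$ (on $[0,\infty)$, in the usual sense) such that, almost surely, $M_t=M^{(n)}_t$ for all $t<T_n$ and all $n$. **Proposition (McKean's argument).** Let $\tau_0$ be a stopping time and let $Z$ be an adapted càdlàg $(0,\infty)$-valued process on $[0,\tau_0)$ such that, almost surely, $$\tau_0=\inf\{\,0<s\le\tau_0 : Z_{s-}=0\,\},\qquad \inf\emptyset=\infty$$ (here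 $Z_{s-}=0$ means that the left limit $\lim_{u\uparrow s}Z_u$ exists and equals $0$). Let $h:(0,\infty)\to\mathbb R$ be continuous with $\lim_{z\downarrow0}h(z)=-\infty$, and suppose that almost surely $$h(Z_t)=h(Z_0)+M_t+P_t\qquad\text{for all } t\in[0,\tau_0),$$ where - $P$ is an adapted càdlàg process on $[0,\tau_0)$ such that for every real $T>0$, $\inf_{t\in[0,\tau_0\wedge T)}P_t>-\infty$ almost surely; - $M$ is a continuous local martingale on $[0,\tau_0)$ with $M_0=0$. Then $\tau_0=\infty$ almost surely. -/

import Mathlib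

open MeasureTheory Filter Topology
open scoped NNReal

/-- The usual hypotheses on a filtered probability space `(Ω, 𝓕∞, (𝓕 t), P)`: the filtration is
right-continuous, and every `P`-null set (`P` of an arbitrary set is its outer measure) belongs
to `𝓕 0`. -/
structure UsualHypotheses {Ω : Type*} {mΩ : MeasurableSpace Ω}
    (𝓕 : Filtration ℝ≥0 mΩ) (P : Measure Ω) : Prop where
  rightContinuous : 𝓕.IsRightContinuous
  complete : ∀ s : Set Ω, P s = 0 → MeasurableSet[𝓕 0] s

/-!
A process on the stochastic interval `[0, T)` is represented by a function `X : ℝ≥0 → Ω → ℝ`.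
Its values `X t ω` at times `t` with `T ω ≤ t` are irrelevant: every notion below looks only at
`X t ω` for `t < T ω`.
-/

/-- `X` is an adapted process on `[0, T)`: for each `t`, the restriction of `X t` to the event
`{t < T}` is measurable for the trace of `𝓕 t` on `{t < T}`. -/
def AdaptedOn {Ω : Type*} {mΩ : MeasurableSpace Ω} (𝓕 : Filtration ℝ≥0 mΩ)
    (T : Ω → WithTop ℝ≥0) (X : ℝ≥0 → Ω → ℝ) : Prop :=
  ∀ t : ℝ≥0,
    Measurable[(𝓕 t).comap (Subtype.val : {ω : Ω // (t : WithTop ℝ≥0) < T ω} → Ω)]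
      (fun ω : {ω : Ω // (t : WithTop ℝ≥0) < T ω} => X t ω)

/-- `X` is càdlàg on `[0, T)`: almost every path is right-continuous on `[0, T)` and has
(finite) left limits on `(0, T)`. (At `t = 0` the filter `𝓝[<] t` on `ℝ≥0` is trivial.) -/
def CadlagOn {Ω : Type*} {mΩ : MeasurableSpace Ω} (P : Measure Ω)
    (T : Ω → WithTop ℝ≥0) (X : ℝ≥0 → Ω → ℝ) : Prop :=
  ∀ᵐ ω ∂P, ∀ t : ℝ≥0, (t : WithTop ℝ≥0) < T ω →
    Tendsto (fun u => X u ω) (𝓝[>] t) (𝓝 (X t ω)) ∧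
      ∃ l : ℝ, Tendsto (fun u => X u ω) (𝓝[<] t) (𝓝 l)

/-- `M` is a continuous local martingale on `[0, T)`: it is adapted on `[0, T)`, and there are an
increasing sequence of stopping times `τ n` converging to `T` almost surely and continuous
martingales `N n` on `[0, ∞)` such that `M t = N n t` on `{t < τ n}`. -/
def IsContinuousLocalMartingaleOn {Ω : Type*} {mΩ : MeasurableSpace Ω}
    (𝓕 : Filtration ℝ≥0 mΩ) (P : Measure Ω)
    (T : Ω → WithTop ℝ≥0) (M : ℝ≥0 → Ω → ℝ) : Prop :=
  AdaptedOn 𝓕 T M ∧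
    ∃ (τ : ℕ → Ω → WithTop ℝ≥0) (N : ℕ → ℝ≥0 → Ω → ℝ),
      (∀ n, IsStoppingTime 𝓕 (τ n)) ∧
      (∀ᵐ ω ∂P, Monotone (fun n => τ n ω)) ∧
      (∀ᵐ ω ∂P, Tendsto (fun n => τ n ω) atTop (𝓝 (T ω))) ∧
      (∀ n, Martingale (N n) 𝓕 P) ∧
      (∀ n, ∀ᵐ ω ∂P, Continuous (fun t => N n t ω)) ∧
      (∀ n, ∀ᵐ ω ∂P, ∀ t : ℝ≥0, (t : WithTop ℝ≥0) < τ n ω → M t ω = N n t ω)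

/-- The first time `s ∈ (0, T]`, `s` finite, at which the left limit `X_{s-}` exists and equals
`0`, along the path `ω`; it is `∞` if there is no such time. At `s = T ω < ∞` this uses only the
values of the path on `[0, T ω)`. -/
noncomputable def firstLeftLimitZero {Ω : Type*}
    (T : Ω → WithTop ℝ≥0) (X : ℝ≥0 → Ω → ℝ) (ω : Ω) : WithTop ℝ≥0 :=
  sInf ((fun s : ℝ≥0 => (s : WithTop ℝ≥0)) ''
    {s : ℝ≥0 | 0 < s ∧ (s : WithTop ℝ≥0) ≤ T ω ∧
      Tendsto (fun u => X u ω) (𝓝[<] s) (𝓝 0)})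

/-! On `τ₀ < ∞` the left limit of `Z` at `τ₀` is `0`, so `h (Z)` tends to `-∞` there; as `V` is
bounded below, `M` must tend to `-∞` at `τ₀`. `IsContinuousLocalMartingaleOn.ae_not_tendsto_atBot`
excludes this almost surely. Stop each localizing martingale when its increment exceeds `K`. Then
`K` minus the stopped increment is nonnegative with expectation `K`, by optional sampling, so by
Fatou its liminf is almost surely finite. On a path bounded above by `K` and tending to `-∞` the cap
never acts, and that liminf would be infinite. -/

/-- The approximation of a nonnegative real `x` from above by a positive multiple of
`1 / (m + 1)`. -/
noncomputable def gridAbove (m : ℕ) (x : ℝ≥0) : ℝ≥0 :=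
  ((⌊((m : ℝ≥0) + 1) * x⌋₊ : ℝ≥0) + 1) / ((m : ℝ≥0) + 1)

lemma lt_gridAbove (m : ℕ) (x : ℝ≥0) : x < gridAbove m x := by
  have hm : (0 : ℝ≥0) < (m : ℝ≥0) + 1 := by positivity
  rw [gridAbove, lt_div_iff₀ hm, mul_comm]
  exact Nat.lt_floor_add_one _

lemma gridAbove_le (m : ℕ) (x : ℝ≥0) : gridAbove m x ≤ x + 1 / ((m : ℝ≥0) + 1) := by
  have hm : (0 : ℝ≥0) < (m : ℝ≥0) + 1 := by positivity
  rw [gridAbove, div_le_iff₀ hm, add_mul x, div_mul_cancel₀ _ hm.ne', mul_comm x]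
  gcongr
  exact Nat.floor_le (zero_le)

lemma gridAbove_le_iff (m : ℕ) (x t : ℝ≥0) :
    gridAbove m x ≤ t ↔ x < (⌊((m : ℝ≥0) + 1) * t⌋₊ : ℝ≥0) / ((m : ℝ≥0) + 1) := by
  have hm : (0 : ℝ≥0) < (m : ℝ≥0) + 1 := by positivity
  rw [gridAbove, div_le_iff₀ hm, lt_div_iff₀ hm, mul_comm t, mul_comm x,
    ← Nat.floor_lt (zero_le), ← Nat.succ_le_iff, Nat.le_floor_iff (zero_le)]
  push_cast
  rfl

lemma tendsto_gridAbove (x : ℝ≥0) : Tendsto (fun m => gridAbove m x) atTop (𝓝 x) := by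
  refine tendsto_of_tendsto_of_tendsto_of_le_of_le tendsto_const_nhds ?_
    (fun m => (lt_gridAbove m x).le) (fun m => gridAbove_le m x)
  simpa using (tendsto_const_nhds (x := x)).add
    (tendsto_one_div_add_atTop_nhds_zero_nat (𝕜 := ℝ≥0))

/-! ### Optional sampling and stopping above a level. -/

section OptionalSampling

variable {Ω : Type*} {mΩ : MeasurableSpace Ω} {P : Measure Ω} {𝓕 : Filtration ℝ≥0 mΩ}

/-- Since `gridAbove` lies strictly above its argument, only the strict events `σ < s` matter, so an
optional time suffices. -/
lemma isStoppingTime_gridAbove {σ : Ω → ℝ≥0} (hσ : ∀ s, MeasurableSet[𝓕 s] {ω | σ ω < s})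
    (m : ℕ) : IsStoppingTime 𝓕 (fun ω => (gridAbove m (σ ω) : WithTop ℝ≥0)) := by
  intro t
  have : {ω | (gridAbove m (σ ω) : WithTop ℝ≥0) ≤ t}
      = {ω | σ ω < (⌊((m : ℝ≥0) + 1) * t⌋₊ : ℝ≥0) / ((m : ℝ≥0) + 1)} := by
    ext ω
    simp only [Set.mem_ofPred_eq, WithTop.coe_le_coe]
    exact gridAbove_le_iff m _ t
  rw [this]
  refine 𝓕.mono ?_ _ (hσ _)
  have hm : (0 : ℝ≥0) < (m : ℝ≥0) + 1 := by positivity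
  rw [div_le_iff₀ hm, mul_comm t]
  exact Nat.floor_le (zero_le)

/-- Optional sampling for a continuous martingale at a bounded optional time. -/
theorem MeasureTheory.Martingale.integrable_and_integral_optionalTime [IsProbabilityMeasure P]
    {N : ℝ≥0 → Ω → ℝ} (hN : Martingale N 𝓕 P) (hNc : ∀ᵐ ω ∂P, Continuous fun t => N t ω)
    {σ : Ω → ℝ≥0} (hσ : ∀ s, MeasurableSet[𝓕 s] {ω | σ ω < s}) {T : ℝ≥0} (hT : ∀ ω, σ ω ≤ T) :
    Integrable (fun ω => N (σ ω) ω) P ∧ ∫ ω, N (σ ω) ω ∂P = ∫ ω, N 0 ω ∂P := by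
  have hst := isStoppingTime_gridAbove hσ
  have hle (m : ℕ) (ω : Ω) : (gridAbove m (σ ω) : WithTop ℝ≥0) ≤ ((T + 1 : ℝ≥0) : WithTop ℝ≥0) := by
    rw [WithTop.coe_le_coe]
    refine (gridAbove_le m _).trans (add_le_add (hT ω) ?_)
    exact div_le_one_of_le₀ (by simp) (zero_le)
  have hrange (m : ℕ) : (Set.range fun ω => (gridAbove m (σ ω) : WithTop ℝ≥0)).Countable := by
    refine (Set.countable_range
      fun k : ℕ => ((((k : ℝ≥0) + 1) / ((m : ℝ≥0) + 1) : ℝ≥0) : WithTop ℝ≥0)).mono ?_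
    rintro _ ⟨ω, rfl⟩
    exact ⟨_, rfl⟩
  -- All sampled values are conditional expectations of the single variable `N (T + 1)`, hence
  -- uniformly integrable.
  have hcond (m : ℕ) : P[N (T + 1) | (hst m).measurableSpace]
      =ᵐ[P] fun ω => N (gridAbove m (σ ω)) ω :=
    (hN.stoppedValue_ae_eq_condExp_of_le_const_of_countable_range (hst m) (hle m) (hrange m)).symm
  have hUI : UniformIntegrable (fun m ω => N (gridAbove m (σ ω)) ω) 1 P :=
    ((hN.integrable (T + 1)).uniformIntegrable_condExp
      fun m => (hst m).measurableSpace_le).ae_eq hcond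
  have hlim : ∀ᵐ ω ∂P, Tendsto (fun m => N (gridAbove m (σ ω)) ω) atTop (𝓝 (N (σ ω) ω)) := by
    filter_upwards [hNc] with ω hω
    exact (hω.tendsto _).comp (tendsto_gridAbove _)
  have hmem : MemLp (fun ω => N (σ ω) ω) 1 P := hUI.memLp_of_ae_tendsto hlim
  have hint := memLp_one_iff_integrable.1 hmem
  refine ⟨hint, ?_⟩
  have hL1 := tendsto_Lp_finite_of_tendsto_ae le_rfl ENNReal.one_ne_top
    hUI.aestronglyMeasurable hmem hUI.unifIntegrable hlim
  have htend := tendsto_integral_of_L1' _ hint.aestronglyMeasurable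
    (Eventually.of_forall fun m => memLp_one_iff_integrable.1 (hUI.memLp m)) hL1
  refine tendsto_nhds_unique htend (tendsto_const_nhds.congr fun m => ?_)
  rw [← integral_congr_ae (hcond m), integral_condExp (hst m).measurableSpace_le,
    ← integral_condExp (𝓕.le 0) (f := N (T + 1)), integral_congr_ae (hN.condExp_ae_eq (zero_le))]

/-- The first time before `T` and before `τ` at which the increment of `N` from time `0` exceeds
the level `K`, where only a countable dense set of times is tested. -/
noncomputable def exceedTime (T : ℝ≥0) (K : ℝ) (τ : Ω → WithTop ℝ≥0) (N : ℝ≥0 → Ω → ℝ)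
    (ω : Ω) : ℝ≥0 :=
  sInf {t : ℝ≥0 | t = T ∨ τ ω ≤ t ∨
    ∃ n : ℕ, TopologicalSpace.denseSeq ℝ≥0 n = t ∧ K < N t ω - N 0 ω}

variable {T : ℝ≥0} {K : ℝ} {τ : Ω → WithTop ℝ≥0} {N : ℝ≥0 → Ω → ℝ}

lemma exceedTime_le (ω : Ω) : exceedTime T K τ N ω ≤ T :=
  csInf_le (OrderBot.bddBelow _) (Or.inl rfl)

/-- The infimum may not be attained, but the strict inequality is a countable condition, whence
measurability. -/
lemma exceedTime_lt_iff {ω : Ω} {s : ℝ≥0} : exceedTime T K τ N ω < s ↔ T < s ∨ τ ω < s ∨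
    ∃ n : ℕ, TopologicalSpace.denseSeq ℝ≥0 n < s ∧
      K < N (TopologicalSpace.denseSeq ℝ≥0 n) ω - N 0 ω := by
  rw [exceedTime, csInf_lt_iff (OrderBot.bddBelow _) ⟨T, Or.inl rfl⟩]
  constructor
  · rintro ⟨t, rfl | h | ⟨n, rfl, h⟩, hts⟩
    · exact Or.inl hts
    · exact Or.inr (Or.inl (h.trans_lt (WithTop.coe_lt_coe.2 hts)))
    · exact Or.inr (Or.inr ⟨n, hts, h⟩)
  · rintro (h | h | ⟨n, hn, h⟩)
    · exact ⟨T, Or.inl rfl, h⟩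
    · obtain ⟨t, ht⟩ := WithTop.ne_top_iff_exists.1 h.ne_top
      exact ⟨t, Or.inr (Or.inl ht.ge), WithTop.coe_lt_coe.1 (ht ▸ h)⟩
    · exact ⟨_, Or.inr (Or.inr ⟨n, rfl, h⟩), hn⟩

lemma measurableSet_exceedTime_lt (hτ : IsStoppingTime 𝓕 τ) (hN : StronglyAdapted 𝓕 N) (s : ℝ≥0) :
    MeasurableSet[𝓕 s] {ω | exceedTime T K τ N ω < s} := by
  simp_rw [exceedTime_lt_iff, Set.ofPred_or, Set.ofPred_exists, Set.ofPred_and]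
  refine (@MeasurableSet.const _ (𝓕 s) _).union ((hτ.measurableSet_lt s).union
    (MeasurableSet.iUnion fun n => ?_))
  by_cases hn : TopologicalSpace.denseSeq ℝ≥0 n < s
  · refine (@MeasurableSet.const _ (𝓕 s) _).inter ?_
    have hm := (((hN (TopologicalSpace.denseSeq ℝ≥0 n)).mono (𝓕.mono hn.le)).sub
      ((hN 0).mono (𝓕.mono (zero_le)))).measurable
    exact hm measurableSet_Ioi
  · simp [hn]

/-- An excess at a positive time would, by continuity, already occur at an earlier dense time; `0 ≤
K` handles time `0`. -/
lemma sub_le_of_le_exceedTime (hK : 0 ≤ K) {ω : Ω} (hω : Continuous fun t => N t ω) :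
    N (exceedTime T K τ N ω) ω - N 0 ω ≤ K := by
  by_contra! hlt
  set t := exceedTime T K τ N ω with ht
  have ht0 : 0 < t := by
    rw [pos_iff_ne_zero]
    intro h0
    rw [h0, sub_self] at hlt
    exact hlt.not_ge hK
  have hev : {u | K < N u ω - N 0 ω} ∈ 𝓝[<] t :=
    mem_nhdsWithin_of_mem_nhds
      ((isOpen_lt continuous_const (hω.sub continuous_const)).mem_nhds hlt)
  obtain ⟨a, ha, hsub⟩ := (mem_nhdsLT_iff_exists_Ioo_subset' ht0).1 hev
  obtain ⟨_, ⟨n, rfl⟩, hq⟩ :=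
    (TopologicalSpace.denseRange_denseSeq ℝ≥0).exists_between (Set.mem_Iio.1 ha)
  exact (exceedTime_lt_iff.2 (Or.inr (Or.inr ⟨n, hq.2, hsub hq⟩))).ne ht.symm

lemma exceedTime_eq {ω : Ω} {s : ℝ≥0} (hs : τ ω = s) (hsT : s ≤ T)
    (hle : ∀ u < s, N u ω - N 0 ω ≤ K) : exceedTime T K τ N ω = s := by
  refine le_antisymm (csInf_le (OrderBot.bddBelow _) (Or.inr (Or.inl hs.le))) ?_
  by_contra! hlt
  obtain h | h | ⟨n, hn, h⟩ := exceedTime_lt_iff.1 hlt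
  · exact h.not_ge hsT
  · exact h.ne hs
  · exact h.not_ge (hle _ hn)

lemma aemeasurable_and_lintegral_exceedTime [IsProbabilityMeasure P] (hτ : IsStoppingTime 𝓕 τ)
    (hN : Martingale N 𝓕 P) (hNc : ∀ᵐ ω ∂P, Continuous fun t => N t ω) (hK : 0 ≤ K) :
    AEMeasurable
      (fun ω => ENNReal.ofReal (K - (N (exceedTime T K τ N ω) ω - N 0 ω))) P ∧
    ∫⁻ ω, ENNReal.ofReal (K - (N (exceedTime T K τ N ω) ω - N 0 ω)) ∂P = ENNReal.ofReal K := by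
  obtain ⟨hi, heq⟩ := hN.integrable_and_integral_optionalTime hNc
    (measurableSet_exceedTime_lt (T := T) (K := K) hτ hN.stronglyAdapted) exceedTime_le
  have hsub : Integrable (fun ω => N (exceedTime T K τ N ω) ω - N 0 ω) P :=
    hi.sub (hN.integrable 0)
  have hint : Integrable (fun ω => K - (N (exceedTime T K τ N ω) ω - N 0 ω)) P :=
    (integrable_const K).sub hsub
  refine ⟨hint.aemeasurable.ennreal_ofReal, ?_⟩
  rw [← ofReal_integral_eq_lintegral_ofReal hint]
  · rw [integral_sub (integrable_const K) hsub, integral_sub hi (hN.integrable 0), heq]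
    simp
  · filter_upwards [hNc] with ω hω
    exact sub_nonneg.2 (sub_le_of_le_exceedTime hK hω)

end OptionalSampling

/-! ### Exclusion of divergence to `-∞`. -/

/-- Along a localizing sequence for a path tending to `-∞` at the finite time `t₀` and bounded above
by `K`, the localizing paths stopped at `exceedTime` have increments tending to `-∞`. -/
lemma tendsto_exceedTime_atBot {Ω : Type*} {t₀ T : ℝ≥0} {K : ℝ} (hT : t₀ ≤ T) {m : ℝ≥0 → ℝ}
    (hm0 : m 0 = 0) (hmK : ∀ u < t₀, m u ≤ K) (hm : Tendsto m (𝓝[<] t₀) atBot)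
    (ht₀ : 0 < t₀) {τ : ℕ → Ω → WithTop ℝ≥0} {N : ℕ → ℝ≥0 → Ω → ℝ} {ω : Ω}
    (hτlt : ∀ n, τ n ω < t₀) (hτ : Tendsto (fun n => τ n ω) atTop (𝓝 (t₀ : WithTop ℝ≥0)))
    (hNc : ∀ n, Continuous fun t => N n t ω)
    (hN : ∀ n, ∀ t : ℝ≥0, (t : WithTop ℝ≥0) < τ n ω → m t = N n t ω) :
    Tendsto (fun n => N n (exceedTime T K (τ n) (N n) ω) ω - N n 0 ω) atTop atBot := by
  rw [tendsto_atBot]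
  intro L
  obtain ⟨a, ha, hsub⟩ := (mem_nhdsLT_iff_exists_Ioo_subset' ht₀).1 (hm.eventually_le_atBot L)
  filter_upwards [hτ.eventually_const_lt (WithTop.coe_lt_coe.2 ha)] with n hn
  obtain ⟨s, hs⟩ := WithTop.ne_top_iff_exists.1 (hτlt n).ne_top
  have hst : s < t₀ := WithTop.coe_lt_coe.1 (hs ▸ hτlt n)
  have has : a < s := WithTop.coe_lt_coe.1 (hs ▸ hn)
  have hNs (u : ℝ≥0) (hu : u < s) : N n u ω = m u :=
    (hN n u (hs ▸ WithTop.coe_lt_coe.2 hu)).symm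
  have hs0 : 0 < s := has.bot_lt
  have hN0 : N n 0 ω = 0 := (hNs 0 hs0).trans hm0
  -- The cap is inactive, so the stopping time is `τ n ω`. Agreement with `m` holds only strictly
  -- before it, so the value there is a left limit.
  rw [exceedTime_eq hs.symm (hst.le.trans hT), hN0, sub_zero]
  · have : (𝓝[<] s).NeBot := nhdsLT_neBot_of_exists_lt ⟨0, hs0⟩
    refine le_of_tendsto ((hNc n).continuousWithinAt (s := Set.Iio s) (x := s)) ?_
    filter_upwards [Ioo_mem_nhdsLT has] with u hu
    rw [hNs u hu.2]
    exact hsub ⟨hu.1, hu.2.trans hst⟩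
  · intro u hu
    rw [hN0, sub_zero, hNs u hu]
    exact hmK u (hu.trans hst)

lemma aemeasurable_liminf {α : Type*} {mα : MeasurableSpace α} {μ : Measure α}
    {f : ℕ → α → ENNReal} (hf : ∀ n, AEMeasurable (f n) μ) :
    AEMeasurable (fun a => liminf (fun n => f n a) atTop) μ := by
  refine ⟨_, Measurable.liminf fun n => (hf n).measurable_mk, ?_⟩
  filter_upwards [ae_all_iff.2 fun n => (hf n).ae_eq_mk] with a ha
  simp_rw [ha]

/-- A continuous local martingale on `[0, T)` starting from `0` does not tend to `-∞` at `T` on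
`{T < ∞}`. -/
theorem IsContinuousLocalMartingaleOn.ae_not_tendsto_atBot {Ω : Type*} {mΩ : MeasurableSpace Ω}
    {P : Measure Ω} [IsProbabilityMeasure P] {𝓕 : Filtration ℝ≥0 mΩ} {T : Ω → WithTop ℝ≥0}
    {M : ℝ≥0 → Ω → ℝ} (hM : IsContinuousLocalMartingaleOn 𝓕 P T M)
    (hM0 : ∀ᵐ ω ∂P, 0 < T ω → M 0 ω = 0) :
    ∀ᵐ ω ∂P, ∀ t : ℝ≥0, T ω = t → 0 < t →
      ¬ Tendsto (fun u => M u ω) (𝓝[<] t) atBot := by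
  obtain ⟨-, τ, N, hτst, -, hτlim, hNmart, hNcont, hMN⟩ := hM
  -- Integer levels and horizons give one null set valid for all path-dependent bounds.
  have hliminf : ∀ᵐ ω ∂P, ∀ k S : ℕ, liminf (fun n => ENNReal.ofReal
      (k - (N n (exceedTime S k (τ n) (N n) ω) ω - N n 0 ω))) atTop < ⊤ := by
    rw [ae_all_iff]; intro k
    rw [ae_all_iff]; intro S
    have hn (n : ℕ) := aemeasurable_and_lintegral_exceedTime (T := (S : ℝ≥0)) (K := k)
      (hτst n) (hNmart n) (hNcont n) k.cast_nonneg
    refine ae_lt_top' (aemeasurable_liminf fun n => (hn n).1) (ne_top_of_le_ne_top ?_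
      (lintegral_liminf_le' fun n => (hn n).1))
    simp_rw [fun n => (hn n).2]
    simp
  filter_upwards [hliminf, hτlim, ae_all_iff.2 hNcont, ae_all_iff.2 hMN, hM0]
    with ω hliminf hlim hcont hMN hM0 t hTt ht hbot
  rw [hTt] at hlim hM0
  have : (𝓝[<] t).NeBot := nhdsLT_neBot_of_exists_lt ⟨0, ht⟩
  -- Otherwise `M` would have the finite left limit `N n t ω` at `t`.
  have hlt (n : ℕ) : τ n ω < t := by
    by_contra! hle
    have hN : Tendsto (fun u => M u ω) (𝓝[<] t) (𝓝 (N n t ω)) := by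
      refine ((hcont n).continuousWithinAt (s := Set.Iio t) (x := t)).congr' ?_
      filter_upwards [self_mem_nhdsWithin] with u hu
      exact (hMN n u ((WithTop.coe_lt_coe.2 hu).trans_le hle)).symm
    exact not_tendsto_nhds_of_tendsto_atBot hbot _ hN
  have hbdd : ∃ C, ∀ u < t, M u ω ≤ C := by
    obtain ⟨a, ha, hsub⟩ := (mem_nhdsLT_iff_exists_Ioo_subset' ht).1 (hbot.eventually_le_atBot 0)
    obtain ⟨n, hn⟩ := (hlim.eventually_const_lt (WithTop.coe_lt_coe.2 ha)).exists
    obtain ⟨C, hC⟩ := (isCompact_Icc (a := 0) (b := a)).bddAbove_image (hcont n).continuousOn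
    refine ⟨max C 0, fun u hu => ?_⟩
    obtain h | h := le_or_gt u a
    · rw [hMN n u ((WithTop.coe_le_coe.2 h).trans_lt hn)]
      exact (hC ⟨u, ⟨zero_le, h⟩, rfl⟩).trans (le_max_left _ _)
    · exact (hsub ⟨h, hu⟩).trans (le_max_right _ _)
  obtain ⟨C, hC⟩ := hbdd
  obtain ⟨k, hk⟩ := exists_nat_ge C
  obtain ⟨S, hS⟩ := exists_nat_ge t
  have key := tendsto_exceedTime_atBot (K := k) hS (hM0 (WithTop.coe_pos.2 ht))
    (fun u hu => (hC u hu).trans hk) hbot ht hlt hlim hcont hMN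
  refine (hliminf k S).ne (Tendsto.liminf_eq ?_)
  refine ENNReal.tendsto_ofReal_atTop.comp ?_
  simp_rw [sub_eq_add_neg (k : ℝ)]
  exact tendsto_atTop_add_const_left _ _ (tendsto_neg_atBot_atTop.comp key)

/-! ### McKean's argument. -/

lemma firstLeftLimitZero_spec {Ω : Type*} {T : Ω → WithTop ℝ≥0} {X : ℝ≥0 → Ω → ℝ} {ω : Ω}
    (hT : T ω = firstLeftLimitZero T X ω) {t : ℝ≥0} (ht : T ω = t) :
    0 < t ∧ Tendsto (fun u => X u ω) (𝓝[<] t) (𝓝 0) := by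
  set S := {s : ℝ≥0 | 0 < s ∧ (s : WithTop ℝ≥0) ≤ T ω ∧
    Tendsto (fun u => X u ω) (𝓝[<] s) (𝓝 0)} with hS
  have hinf : sInf ((fun s : ℝ≥0 => (s : WithTop ℝ≥0)) '' S) = t := hT.symm.trans ht
  obtain ⟨s, hs⟩ : S.Nonempty := by
    rw [Set.nonempty_iff_ne_empty]
    intro h0
    rw [h0, Set.image_empty, WithTop.sInf_empty] at hinf
    exact WithTop.coe_ne_top hinf.symm
  -- Elements of `S` are at most `T ω`, which is also their infimum, so `s = t`.
  have hts : (t : WithTop ℝ≥0) ≤ s := hinf ▸ csInf_le (OrderBot.bddBelow _) ⟨s, hs, rfl⟩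
  have hst : (s : WithTop ℝ≥0) ≤ t := ht ▸ hs.2.1
  obtain rfl : s = t := WithTop.coe_injective (le_antisymm hst hts)
  exact ⟨hs.1, hs.2.2⟩

theorem proposition4p3 {Ω : Type*} {mΩ : MeasurableSpace Ω}
    (P : Measure Ω) [IsProbabilityMeasure P]
    (𝓕 : Filtration ℝ≥0 mΩ) (h𝓕 : UsualHypotheses 𝓕 P)
    (τ₀ : Ω → WithTop ℝ≥0) (hτ₀ : IsStoppingTime 𝓕 τ₀)
    -- `Z` is an adapted càdlàg process on `[0, τ₀)` with values in `(0, ∞)`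
    (Z : ℝ≥0 → Ω → ℝ)
    (hZ_adapted : AdaptedOn 𝓕 τ₀ Z) (hZ_cadlag : CadlagOn P τ₀ Z)
    (hZ_pos : ∀ᵐ ω ∂P, ∀ t : ℝ≥0, (t : WithTop ℝ≥0) < τ₀ ω → 0 < Z t ω)
    -- `τ₀ = inf {0 < s ≤ τ₀ : Z_{s-} = 0}`
    (hτ₀_hit : ∀ᵐ ω ∂P, τ₀ ω = firstLeftLimitZero τ₀ Z ω)
    (h : ℝ → ℝ) (h_cont : ContinuousOn h (Set.Ioi 0))
    -- `V` is an adapted càdlàg process on `[0, τ₀)`, bounded below on compacts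
    (V : ℝ≥0 → Ω → ℝ)
    (hV_adapted : AdaptedOn 𝓕 τ₀ V) (hV_cadlag : CadlagOn P τ₀ V)
    (hV_bdd : ∀ T : ℝ≥0, 0 < T → ∀ᵐ ω ∂P,
      BddBelow ((fun t => V t ω) '' {t : ℝ≥0 | (t : WithTop ℝ≥0) < min (τ₀ ω) T}))
    -- `M` is a continuous local martingale on `[0, τ₀)` with `M 0 = 0`
    (M : ℝ≥0 → Ω → ℝ)
    (hM : IsContinuousLocalMartingaleOn 𝓕 P τ₀ M)
    (hM_zero : ∀ᵐ ω ∂P, 0 < τ₀ ω → M 0 ω = 0)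
    (h_decomp : ∀ᵐ ω ∂P, ∀ t : ℝ≥0, (t : WithTop ℝ≥0) < τ₀ ω →
      h (Z t ω) = h (Z 0 ω) + M t ω + V t ω)
    (h_lim : Tendsto h (𝓝[>] 0) atBot) :
    ∀ᵐ ω ∂P, τ₀ ω = ⊤ := by

  have hV (S : ℕ) := hV_bdd ((S : ℝ≥0) + 1) (by positivity)
  filter_upwards [hM.ae_not_tendsto_atBot hM_zero, hτ₀_hit, hZ_pos, h_decomp, ae_all_iff.2 hV]
    with ω hnot hhit hpos hdec hV
  by_contra hne
  obtain ⟨t, ht⟩ := WithTop.ne_top_iff_exists.1 hne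
  obtain ⟨ht0, hZ⟩ := firstLeftLimitZero_spec hhit ht.symm
  refine hnot t ht.symm ht0 ?_
  have hlt : ∀ᶠ u : ℝ≥0 in 𝓝[<] t, (u : WithTop ℝ≥0) < τ₀ ω := by
    filter_upwards [self_mem_nhdsWithin] with u hu
    exact ht ▸ WithTop.coe_lt_coe.2 hu
  have hhZ : Tendsto (fun u => h (Z u ω)) (𝓝[<] t) atBot :=
    h_lim.comp (tendsto_nhdsWithin_iff.2 ⟨hZ, hlt.mono fun u hu => hpos u hu⟩)
  obtain ⟨S, hS⟩ := exists_nat_ge t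
  obtain ⟨c, hc⟩ := hV S
  -- With `c ≤ V`, the decomposition gives `M ≤ h (Z) - h (Z 0) - c` near `t`.
  refine tendsto_atBot_mono' _ ?_ (tendsto_atBot_add_const_right _ (-h (Z 0 ω) - c) hhZ)
  filter_upwards [hlt, self_mem_nhdsWithin] with u hu hut
  have hcV : c ≤ V u ω := by
    refine hc ⟨u, lt_min hu (WithTop.coe_lt_coe.2 ?_), rfl⟩
    exact (Set.mem_Iio.1 hut).trans_le (hS.trans (le_add_of_nonneg_right zero_le_one))
  linarith [hdec u hu]
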